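/- Let $V$ be a finite set and let $\mathcal Y_V=(Y_V(t))_{t\in\mathbb R}$, $Y_V(t)=(Y_a(t))_{a\in V}$, be a complex-valued (in particular, possibly real-valued) process on a probability space that is wide-sense stationary, mean-square continuous, and has expectation zero. Suppose it has a spectral density function, that is, an integrable $f=f_{Y_VY_V}:\mathbb R\to\mathbb C^{V\times V}$ with $$\mathbb E\big[Y_V(t)\overline{Y_V(0)}^{\top}\big]=\int_{-\infty}^{\infty}e^{i\lambda t}f(\lambda)\,d\lambda\qquad\text{for all }t\in\mathbb R .$$ For $S\subseteq V$ write $f_{Y_SY_S}(\lambda)=[f(\lambda)]_{SS}$ for the submatrix indexed by $S$, and let $\mathcal L_{Y_S}$ be the mean-square closure in $L^2$ of the complex linear span of $\{Y_c(t):c\in S,\ t\in\mathbb R\}$, with orthogonal projection $P_{\mathcal L_{Y_S}}$. For $A,B,C\subseteq V$, the subprocesses $\mathcal Y_A$ and $\mathcal Y_B$ are called partially uncorrelated given $\mathcal Y_C$ if the noise processes $\varepsilon_{a|C}(t)=Y_a(t)-P_{\mathcal L_{Y_C}}Y_a(t)$ satisfy $$\mathbb E\big[\varepsilon_{a|C}(s)\,\overline{\varepsilon_{b|C}(t)}\big]=0\qquad\text{for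 all }a\in A,\ b\in B,\ s,t\in\mathbb R .$$ **Proposition.** Let $A,B,C\subseteq V$ be pairwise disjoint and suppose that $f_{Y_{A\cup B\cup C}Y_{A\cup B\cup C}}(\lambda)$ is positive definite for every $\lambda\in\mathbb R$. Put $g(\lambda)=f_{Y_{A\cup B\cup C}Y_{A\cup B\cup C}}(\lambda)^{-1}$. Then $\mathcal Y_A$ and $\mathcal Y_B$ are partially uncorrelated given $\mathcal Y_C$ if and only if $[g(\lambda)]_{AB}=0$ for almost all $\lambda\in\mathbb R$. -/

import Mathlib

open MeasureTheory Filter Topology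
open scoped ComplexOrder

namespace PartialCorrelation

noncomputable section

variable {Ω V : Type*} [MeasurableSpace Ω]

/-- A multivariate process `Y` with components `Y a = (Y a t)`, `a ∈ V`, `t ∈ ℝ`, is wide-sense
stationary: it has finite second moments, constant mean, and covariances
`E[Y a (t + h) * conj (Y b (s + h))]` that do not depend on the shift `h`. -/
structure IsWideSenseStationary (P : Measure Ω) (Y : V → ℝ → Ω → ℂ) : Prop where
  memLp : ∀ a t, MemLp (Y a t) 2 P
  mean : ∀ a s t, ∫ ω, Y a s ω ∂P = ∫ ω, Y a t ω ∂P
  cov : ∀ a b s t h,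
    ∫ ω, Y a (t + h) ω * star (Y b (s + h) ω) ∂P = ∫ ω, Y a t ω * star (Y b s ω) ∂P

/-- The process has expectation zero. -/
def HasMeanZero (P : Measure Ω) (Y : V → ℝ → Ω → ℂ) : Prop :=
  ∀ a t, ∫ ω, Y a t ω ∂P = 0

/-- The process is mean-square continuous. -/
def IsMeanSquareContinuous (P : Measure Ω) (Y : V → ℝ → Ω → ℂ) : Prop :=
  ∀ a t, Tendsto (fun s => ∫ ω, ‖Y a s ω - Y a t ω‖ ^ 2 ∂P) (𝓝 t) (𝓝 0)

/-- The autocovariance function `c(t) = E[Y(t) Y(0)ᴴ]` of a centred stationary process (for a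
real-valued process this is `E[Y(t) Y(0)ᵀ]`). -/
def autocov (P : Measure Ω) (Y : V → ℝ → Ω → ℂ) (t : ℝ) : Matrix V V ℂ :=
  Matrix.of fun a b => ∫ ω, Y a t ω * star (Y b 0 ω) ∂P

/-- `f` is a spectral density function of the centred stationary process `Y`: it is integrable and
`c(t) = ∫ exp(iλt) f(λ) dλ` for all `t`. (It is then determined almost everywhere by `Y`, and
`f(λ)` is Hermitian and positive semi-definite for almost all `λ`.) -/
structure HasSpectralDensity (P : Measure Ω) (Y : V → ℝ → Ω → ℂ) (f : ℝ → Matrix V V ℂ) :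
    Prop where
  integrable : ∀ a b, Integrable (fun x : ℝ => f x a b)
  autocov_eq : ∀ t a b,
    autocov P Y t a b = ∫ x : ℝ, Complex.exp (Complex.I * (x : ℂ) * (t : ℂ)) * f x a b

/-- The closed linear space generated by `Y c t`, `c ∈ C`, `t ∈ ℝ`: the mean-square closure of the
set of all finite complex linear combinations. -/
def linearSpace (P : Measure Ω) (Y : V → ℝ → Ω → ℂ) (C : Finset V) : Submodule ℂ (Lp ℂ 2 P) :=
  (Submodule.span ℂ {X : Lp ℂ 2 P | ∃ c ∈ C, ∃ t : ℝ, X =ᵐ[P] Y c t}).topologicalClosure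

instance (P : Measure Ω) (Y : V → ℝ → Ω → ℂ) (C : Finset V) :
    CompleteSpace (linearSpace P Y C) :=
  (Submodule.isClosed_topologicalClosure _).completeSpace_coe

/-- The noise process `ε_{a|C}(t) = Y_a(t) - P_{L(Y_C)} Y_a(t)`, where `P_{L(Y_C)}` is the
orthogonal projection in `L²` onto the closed linear space generated by `Y_C`. -/
def noise {P : Measure Ω} {Y : V → ℝ → Ω → ℂ} (hY : IsWideSenseStationary P Y) (C : Finset V)
    (a : V) (t : ℝ) : Lp ℂ 2 P :=
  (hY.memLp a t).toLp - (linearSpace P Y C).starProjection (hY.memLp a t).toLp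

/-- `Y_A` and `Y_B` are partially uncorrelated given `Y_C`: the noise processes of `Y_A` and `Y_B`
given `Y_C` are uncorrelated, that is, their cross-covariance function vanishes (at all pairs of
times). -/
def PartiallyUncorrelated {P : Measure Ω} {Y : V → ℝ → Ω → ℂ} (hY : IsWideSenseStationary P Y)
    (A B C : Finset V) : Prop :=
  ∀ a ∈ A, ∀ b ∈ B, ∀ s t : ℝ, ∫ ω, noise hY C a s ω * star (noise hY C b t ω) ∂P = 0

/-- The spectral density `f_{Y_S Y_S}(λ) = [f(λ)]_{SS}` of the subprocess `Y_S`. -/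
def subDensity (f : ℝ → Matrix V V ℂ) (S : Finset V) (x : ℝ) : Matrix S S ℂ :=
  (f x).submatrix Subtype.val Subtype.val

/-- The inverse `g_{Y_S Y_S}(λ) = f_{Y_S Y_S}(λ)⁻¹`. -/
def invDensity [DecidableEq V] (f : ℝ → Matrix V V ℂ) (S : Finset V) (x : ℝ) : Matrix S S ℂ :=
  (subDensity f S x)⁻¹

/-- The block `[M]_{AB}` of a matrix `M` indexed by `S`, for `A, B ⊆ S`. -/
def block {S : Finset V} (M : Matrix S S ℂ) {A B : Finset V} (hA : A ⊆ S) (hB : B ⊆ S) :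
    Matrix A B ℂ :=
  M.submatrix (fun a => ⟨a.1, hA a.2⟩) (fun b => ⟨b.1, hB b.2⟩)

end

end PartialCorrelation

/-!
The noise processes are computed in the spectral domain. Let `S = A ∪ B ∪ C` and factorise the
spectral density pointwise as the Gram matrix `f_{ab}(x) = ⟪r_b(x), r_a(x)⟫` of measurable vectors
`r_a(x)`, the rows of the matrix square root (`exists_memLp_gram_eq`). The random variables `Y_a(t)`
and the functions `x ↦ exp (i x t) r_a(x)` of `L²(ℝ; ℂ^S)` have the same inner products, and the
covariances of residuals after projection onto a closed span of a subfamily depend on these only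
(`inner_residual_eq`).

In `L²(ℝ; ℂ^S)` the projection onto the closed span of the functions belonging to `C` is taken
pointwise in the frequency `x`: the pointwise predictor has the required orthogonality, and it lies
in the closed span because a vector orthogonal to all `exp (i x t) r_c(x)` is orthogonal to `r_c(x)`
for almost every `x`, by uniqueness of the Fourier transform of integrable functions
(`modulated_mem_closure_span`). Hence the noise covariance at times `s`, `t` is the Fourier integral
at `s - t` of the Schur complement `f_{ab} - f_{aC} f_{CC}⁻¹ f_{Cb}`
(`PartialCorrelation.integral_noise_eq`). By uniqueness again it vanishes at all times if and only
if the Schur complement vanishes almost everywhere.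

The block of `f_{SS}⁻¹` on `A ∪ B` is the inverse of the Schur complement, and for mutually inverse
matrices the vanishing of one off-diagonal block of one is equivalent to the vanishing of the same
block of the other (`Matrix.partialCov_block_eq_zero_iff`).
-/

/-! ### Characters and uniqueness of the Fourier transform -/

/-- The function `x ↦ exp (i x t)` of the frequency `x`, for a fixed time `t`. -/
noncomputable def character (t x : ℝ) : ℂ := Complex.exp (Complex.I * (x : ℂ) * (t : ℂ))

theorem norm_character (t x : ℝ) : ‖character t x‖ = 1 := by
  rw [character, mul_assoc, ← Complex.ofReal_mul, mul_comm, Complex.norm_exp_ofReal_mul_I]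

theorem continuous_character (t : ℝ) : Continuous (character t) := by
  unfold character; fun_prop

theorem star_character_mul (s t x : ℝ) :
    starRingEnd ℂ (character s x) * character t x = character (t - s) x := by
  simp only [character, ← Complex.exp_conj, ← Complex.exp_add]
  congr 1
  simp
  ring

/-- An integrable function on `ℝ` whose Fourier transform vanishes identically is zero almost
everywhere. -/
theorem ae_eq_zero_of_forall_integral_exp_mul_eq_zero {h : ℝ → ℂ} (hh : Integrable h)
    (h0 : ∀ t : ℝ, ∫ x : ℝ, character t x * h x = 0) :
    ∀ᵐ x : ℝ, h x = 0 := by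
  refine ae_eq_zero_of_integral_contDiff_smul_eq_zero hh.locallyIntegrable fun g hg hgs => ?_
  have hgs' : HasCompactSupport (fun x => (g x : ℂ)) :=
    hgs.comp_left (g := fun x : ℝ => (x : ℂ)) rfl
  have hg' : ContDiff ℝ (⊤ : ℕ∞) (fun x => (g x : ℂ)) := Complex.ofRealCLM.contDiff.comp hg
  let G : SchwartzMap ℝ ℂ := hgs'.toSchwartzMap hg'
  -- By self-adjointness of the Fourier transform, `∫ h * G = ∫ (𝓕 h) * (𝓕⁻¹ G) = 0`.
  let Φ : SchwartzMap ℝ ℂ := FourierTransform.fourierInv G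
  have key := VectorFourier.integral_fourierIntegral_smul_eq_flip (μ := volume) (ν := volume)
    (L := innerₗ ℝ) (e := Real.fourierChar) (f := h) (g := (Φ : ℝ → ℂ)) Real.continuous_fourierChar
    continuous_inner hh Φ.integrable
  have hz : ∀ ξ : ℝ, VectorFourier.fourierIntegral Real.fourierChar volume (innerₗ ℝ) h ξ = 0 := by
    intro ξ
    rw [← h0 (-2 * Real.pi * ξ)]
    refine integral_congr_ae (Eventually.of_forall fun x => ?_)
    simp only [character, Circle.smul_def, Real.fourierChar_apply, smul_eq_mul]
    congr 2
    simp
    ring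
  simp only [hz, zero_smul, integral_zero] at key
  have hG : FourierTransform.fourier Φ = G := FourierTransform.fourier_fourierInv_eq G
  rw [key]
  refine integral_congr_ae (Eventually.of_forall fun x => ?_)
  have h1 : VectorFourier.fourierIntegral Real.fourierChar volume (innerₗ ℝ).flip
      (Φ : ℝ → ℂ) x = G x := by
    rw [← hG, SchwartzMap.fourier_coe, flip_innerₗ]; rfl
  simp only
  rw [h1]
  change g x • h x = h x • (g x : ℂ)
  simp [mul_comm]

/-! ### Projections and Gram matrices -/

section
variable {H K ι : Type*} [NormedAddCommGroup H] [InnerProductSpace ℂ H]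
    [NormedAddCommGroup K] [InnerProductSpace ℂ K]

theorem inner_linearCombination_eq {u : ι → H} {v : ι → K}
    (huv : ∀ i j, inner ℂ (u i) (u j) = inner ℂ (v i) (v j)) (x y : ι →₀ ℂ) :
    inner ℂ (Finsupp.linearCombination ℂ u x) (Finsupp.linearCombination ℂ u y) =
      inner ℂ (Finsupp.linearCombination ℂ v x) (Finsupp.linearCombination ℂ v y) := by
  simp only [Finsupp.linearCombination_apply, Finsupp.sum, sum_inner, inner_sum, inner_smul_left,
    inner_smul_right, huv]

theorem norm_linearCombination_eq {u : ι → H} {v : ι → K}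
    (huv : ∀ i j, inner ℂ (u i) (u j) = inner ℂ (v i) (v j)) (x : ι →₀ ℂ) :
    ‖Finsupp.linearCombination ℂ u x‖ = ‖Finsupp.linearCombination ℂ v x‖ := by
  rw [@norm_eq_sqrt_re_inner ℂ, @norm_eq_sqrt_re_inner ℂ, inner_linearCombination_eq huv]

/-- If the families `u` and `v` have the same Gram matrix and `q` is the projection of `v i` onto the
closed span of `v j`, `j ∈ J`, then a single sequence of coefficient vectors approximates the residuals of
`u i` and of `v i` simultaneously. Orthogonality of `v i - q` to the `v j` characterises `q` as that
projection, so no completeness of `K` is needed. -/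
theorem exists_tendsto_residual [CompleteSpace H] {u : ι → H} {v : ι → K}
    (huv : ∀ i j, inner ℂ (u i) (u j) = inner ℂ (v i) (v j)) (J : Set ι)
    (U : Submodule ℂ H) [U.HasOrthogonalProjection]
    (hU : U = (Submodule.span ℂ (u '' J)).topologicalClosure) (i : ι) {q : K}
    (hq : q ∈ (Submodule.span ℂ (v '' J)).topologicalClosure)
    (hort : ∀ j ∈ J, inner ℂ (v j) (v i - q) = 0) :
    ∃ x : ℕ → ι →₀ ℂ,
      Tendsto (fun n => Finsupp.linearCombination ℂ u (x n)) atTop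
        (𝓝 (u i - U.starProjection (u i))) ∧
      Tendsto (fun n => Finsupp.linearCombination ℂ v (x n)) atTop (𝓝 (v i - q)) := by
  obtain ⟨y, hy, hyq⟩ := mem_closure_iff_seq_limit.1 hq
  choose z hzJ hz using fun n => (Finsupp.mem_span_image_iff_linearCombination ℂ).1 (hy n)
  have hvz : Tendsto (fun n => Finsupp.linearCombination ℂ v (z n)) atTop (𝓝 q) := by
    simpa only [hz] using hyq
  have hcau : CauchySeq fun n => Finsupp.linearCombination ℂ u (z n) := by
    have := hvz.cauchySeq
    rw [Metric.cauchySeq_iff] at this ⊢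
    simpa only [dist_eq_norm, ← map_sub, norm_linearCombination_eq huv] using this
  -- The limit `p` of the corresponding combinations of `u` is the projection of `u i` onto `U`.
  obtain ⟨p, hp⟩ := cauchySeq_tendsto_of_complete hcau
  have hvi : ∀ n, v i - Finsupp.linearCombination ℂ v (z n) =
      Finsupp.linearCombination ℂ v (Finsupp.single i 1 - z n) := fun n => by simp
  have hui : ∀ n, u i - Finsupp.linearCombination ℂ u (z n) =
      Finsupp.linearCombination ℂ u (Finsupp.single i 1 - z n) := fun n => by simp
  have hpU : p ∈ U := by
    rw [hU]
    refine mem_closure_of_tendsto hp (Eventually.of_forall fun n => ?_)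
    exact (Finsupp.mem_span_image_iff_linearCombination ℂ).2 ⟨z n, hzJ n, rfl⟩
  have hpo : u i - p ∈ Uᗮ := by
    rw [hU, Submodule.orthogonal_closure, Submodule.mem_orthogonal]
    intro w hw
    induction hw using Submodule.span_induction with
    | mem w hw =>
      obtain ⟨j, hj, rfl⟩ := hw
      have h1 := (tendsto_const_nhds (x := u j)).inner (𝕜 := ℂ) (hp.const_sub (u i))
      have h2 := (tendsto_const_nhds (x := v j)).inner (𝕜 := ℂ) (hvz.const_sub (v i))
      have h3 := inner_linearCombination_eq huv (Finsupp.single j 1)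
      simp only [Finsupp.linearCombination_single, one_smul] at h3
      simp only [hui, h3] at h1
      simp only [hvi] at h2
      exact (tendsto_nhds_unique h1 h2).trans (hort j hj)
    | zero => simp
    | add a b _ _ ha hb => rw [inner_add_left, ha, hb, add_zero]
    | smul c a _ ha => rw [inner_smul_left, ha, mul_zero]
  have hP : U.starProjection (u i) = p := Submodule.eq_starProjection_of_mem_orthogonal hpU hpo
  refine ⟨fun n => Finsupp.single i 1 - z n, ?_, ?_⟩
  · simp only [← hui, hP]
    exact tendsto_const_nhds.sub hp
  · simp only [← hvi]
    exact tendsto_const_nhds.sub hvz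

/-- The inner products of the residuals of a family, after projection onto the closed span of a
subfamily, are determined by the Gram matrix of the family. -/
theorem inner_residual_eq [CompleteSpace H] {u : ι → H} {v : ι → K}
    (huv : ∀ i j, inner ℂ (u i) (u j) = inner ℂ (v i) (v j)) (J : Set ι)
    (U : Submodule ℂ H) [U.HasOrthogonalProjection]
    (hU : U = (Submodule.span ℂ (u '' J)).topologicalClosure) {q : ι → K}
    (hq : ∀ i, q i ∈ (Submodule.span ℂ (v '' J)).topologicalClosure)
    (hort : ∀ i, ∀ j ∈ J, inner ℂ (v j) (v i - q i) = 0) (i j : ι) :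
    inner ℂ (u i - U.starProjection (u i)) (u j - U.starProjection (u j)) =
      inner ℂ (v i - q i) (v j - q j) := by
  obtain ⟨x, hxu, hxv⟩ := exists_tendsto_residual huv J U hU i (hq i) (hort i)
  obtain ⟨y, hyu, hyv⟩ := exists_tendsto_residual huv J U hU j (hq j) (hort j)
  refine tendsto_nhds_unique (hxu.inner hyu) ?_
  simpa only [inner_linearCombination_eq huv] using hxv.inner hyv

end

/-! ### Measurability of the square root and of the inverse of a matrix -/

section
open scoped Matrix.Norms.L2Operator MatrixOrder

/-- The matrix square root is continuous on the cone of positive semidefinite matrices. -/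
theorem continuous_sqrt_nonneg {n : Type*} [Fintype n] [DecidableEq n] :
    Continuous (fun M : {M : Matrix n n ℂ // 0 ≤ M} => CFC.sqrt M.1) := by
  have : ∀ M : {M : Matrix n n ℂ // 0 ≤ M}, CFC.sqrt M.1 = cfc NNReal.sqrt M.1 := fun M =>
    CFC.sqrt_eq_cfc
  simp only [this]
  exact Continuous.cfc_nnreal_of_mem_nhdsSet (s := Set.univ) _ univ_mem
    continuous_subtype_val (fun M => M.2)

theorem Matrix.aestronglyMeasurable_of_apply {X m n : Type*} [MeasurableSpace X] {μ : Measure X}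
    [Fintype m] [Fintype n] [DecidableEq m] [DecidableEq n] {F : X → Matrix m n ℂ}
    (hF : ∀ a b, AEStronglyMeasurable (fun x => F x a b) μ) : AEStronglyMeasurable F μ := by
  have : F = fun x => ∑ a, ∑ b, F x a b • Matrix.single a b (1 : ℂ) := by
    ext1 x
    conv_lhs => rw [Matrix.matrix_eq_sum_single (F x)]
    simp
  rw [this]
  exact Finset.aestronglyMeasurable_fun_sum _ fun a _ =>
    Finset.aestronglyMeasurable_fun_sum _ fun b _ => (hF a b).smul_const _

/-- A measurable family of positive semidefinite matrices has a measurable factorisation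
`F = R * Rᴴ`. -/
theorem exists_aestronglyMeasurable_sqrt {X n : Type*} [MeasurableSpace X] {μ : Measure X}
    [Fintype n] [DecidableEq n] {F : X → Matrix n n ℂ} (hpos : ∀ x, (F x).PosSemidef)
    (hF : ∀ a b, AEStronglyMeasurable (fun x => F x a b) μ) :
    ∃ R : X → Matrix n n ℂ, (∀ a b, AEStronglyMeasurable (fun x => R x a b) μ) ∧
      ∀ x, R x * (R x).conjTranspose = F x := by
  have hF' := Matrix.aestronglyMeasurable_of_apply hF
  have hF0 : ∀ x, 0 ≤ F x := fun x => Matrix.nonneg_iff_posSemidef.2 (hpos x)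
  have hsub : AEStronglyMeasurable (fun x => (⟨F x, hF0 x⟩ : {M : Matrix n n ℂ // 0 ≤ M})) μ :=
    Topology.IsEmbedding.subtypeVal.aestronglyMeasurable_comp_iff.1 hF'
  refine ⟨fun x => CFC.sqrt (F x), fun a b => ?_, fun x => ?_⟩
  · have : Continuous (fun M : Matrix n n ℂ => M a b) := continuous_id.matrix_elem a b
    exact (this.comp continuous_sqrt_nonneg).comp_aestronglyMeasurable hsub
  · have : (CFC.sqrt (F x)).conjTranspose = CFC.sqrt (F x) :=
      (Matrix.nonneg_iff_posSemidef.1 (CFC.sqrt_nonneg (F x))).isHermitian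
    rw [this]
    exact CFC.sqrt_mul_sqrt_self _ (hF0 x)

theorem Matrix.aestronglyMeasurable_inv_apply {X n : Type*} [MeasurableSpace X] {μ : Measure X}
    [Fintype n] [DecidableEq n] {F : X → Matrix n n ℂ}
    (hF : ∀ a b, AEStronglyMeasurable (fun x => F x a b) μ) (a b : n) :
    AEStronglyMeasurable (fun x => (F x)⁻¹ a b) μ := by
  have hF' := Matrix.aestronglyMeasurable_of_apply hF
  have h1 : AEStronglyMeasurable (fun x => (F x).det) μ :=
    (continuous_id.matrix_det).comp_aestronglyMeasurable hF'
  have h2 : AEStronglyMeasurable (fun x => (F x).adjugate a b) μ :=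
    ((continuous_id.matrix_adjugate).matrix_elem a b).comp_aestronglyMeasurable hF'
  simp only [Matrix.inv_def, Ring.inverse_eq_inv', Matrix.smul_apply, smul_eq_mul]
  exact h1.aemeasurable.inv.aestronglyMeasurable.mul h2

end

/-! ### Schur complements -/

namespace Matrix
variable {n m p q : Type*} [Fintype m] [DecidableEq m]

/-- The matrix `M_{·C} M_{CC}⁻¹` of regression coefficients on the indices in the range of `e`; for a
covariance matrix `M` it gives the best linear predictor from these coordinates. -/
noncomputable def regressionCoeff (M : Matrix n n ℂ) (e : m → n) : Matrix n m ℂ :=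
  M.submatrix id e * (M.submatrix e e)⁻¹

/-- The Schur complement `M - M_{·C} M_{CC}⁻¹ M_{C·}`, indexed by all of `n`, where `C` is the range
of `e`. Its rows and columns in `C` vanish when `M_{CC}` is invertible. -/
noncomputable def partialCov (M : Matrix n n ℂ) (e : m → n) : Matrix n n ℂ :=
  M - regressionCoeff M e * M.submatrix e id

theorem partialCov_submatrix_eq_zero {M : Matrix n n ℂ} {e : m → n}
    (hM : IsUnit (M.submatrix e e).det) : (partialCov M e).submatrix id e = 0 := by
  have : (partialCov M e).submatrix id e =
    M.submatrix id e - M.submatrix id e * (M.submatrix e e)⁻¹ * M.submatrix e e := rfl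
  rw [this, Matrix.mul_assoc, Matrix.nonsing_inv_mul _ hM, Matrix.mul_one, sub_self]

variable [Fintype n] [DecidableEq n] [Fintype p] [Fintype q] [DecidableEq p] [DecidableEq q]

/-- The block of `M⁻¹` on the complement of `C` is the inverse of the Schur complement of `M_{CC}`. -/
theorem submatrix_partialCov_mul_inv {M : Matrix n n ℂ} {e : m → n} {r : p → n}
    (hM : IsUnit M.det) (hMe : IsUnit (M.submatrix e e).det)
    (hb : Function.Bijective (Sum.elim r e)) :
    (partialCov M e).submatrix r r * (M⁻¹).submatrix r r = 1 := by
  have h0 := partialCov_submatrix_eq_zero hMe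
  -- Since the columns of the Schur complement in `C` vanish, the product with `M⁻¹` is computed on
  -- the complement of `C`, and there `M_{C·} M⁻¹ = 1_{C·}` vanishes.
  have h1 : partialCov M e * M⁻¹ = 1 - regressionCoeff M e * (1 : Matrix n n ℂ).submatrix e id := by
    rw [partialCov, Matrix.sub_mul, Matrix.mul_nonsing_inv _ hM, Matrix.mul_assoc]
    congr 2
    rw [← Matrix.mul_nonsing_inv _ hM]
    rfl
  ext i j
  have h2 := congr_fun₂ h1 (r i) (r j)
  have hne : ∀ c, e c ≠ r j := fun c hc => by
    have := hb.1 (show Sum.elim r e (Sum.inr c) = Sum.elim r e (Sum.inl j) from hc)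
    simp at this
  have hr : Function.Injective r := fun a b h => Sum.inl_injective (hb.1 h)
  rw [Matrix.mul_apply, ← (Equiv.ofBijective _ hb).sum_comp, Fintype.sum_sum_type] at h2
  have h3 : ∀ c, partialCov M e (r i) (e c) = 0 := fun c => congr_fun₂ h0 (r i) c
  simp only [Equiv.ofBijective_apply, Sum.elim_inl, Sum.elim_inr, h3, zero_mul,
    Finset.sum_const_zero, add_zero] at h2
  rw [Matrix.mul_apply]
  simp only [Matrix.submatrix_apply]
  rw [h2, Matrix.sub_apply, Matrix.mul_apply, Matrix.one_apply, Matrix.one_apply]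
  simp [hne, hr.eq_iff]

/-- The inverse of a block lower triangular matrix is block lower triangular. -/
theorem toBlocks₁₂_eq_zero_of_mul_eq_one {X Z : Matrix (p ⊕ q) (p ⊕ q) ℂ} (h : X * Z = 1)
    (hX : X.toBlocks₁₂ = 0) : Z.toBlocks₁₂ = 0 := by
  rw [← X.fromBlocks_toBlocks, ← Z.fromBlocks_toBlocks, Matrix.fromBlocks_multiply,
    ← Matrix.fromBlocks_one, Matrix.fromBlocks_inj, hX] at h
  simp only [Matrix.zero_mul, add_zero] at h
  obtain ⟨h1, h2, -, -⟩ := h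
  rw [← Matrix.one_mul Z.toBlocks₁₂, ← mul_eq_one_comm.1 h1, Matrix.mul_assoc, h2,
    Matrix.mul_zero]

theorem toBlocks₁₂_eq_zero_iff_of_mul_eq_one {X Z : Matrix (p ⊕ q) (p ⊕ q) ℂ} (h : X * Z = 1) :
    X.toBlocks₁₂ = 0 ↔ Z.toBlocks₁₂ = 0 :=
  ⟨toBlocks₁₂_eq_zero_of_mul_eq_one h, toBlocks₁₂_eq_zero_of_mul_eq_one (mul_eq_one_comm.1 h)⟩

/-- If the indices split into `A`, `B` and `C`, the Schur complement of `M_{CC}` and the inverse of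
`M` have vanishing blocks at `A × B` simultaneously. -/
theorem partialCov_block_eq_zero_iff {M : Matrix n n ℂ} {e : m → n} {α : p → n} {β : q → n}
    (hM : M.PosDef) (hb : Function.Bijective (Sum.elim (Sum.elim α β) e)) :
    (partialCov M e).submatrix α β = 0 ↔ (M⁻¹).submatrix α β = 0 := by
  have he : Function.Injective e := fun a b h => Sum.inr_injective (hb.1 h)
  exact toBlocks₁₂_eq_zero_iff_of_mul_eq_one (submatrix_partialCov_mul_inv
    ((Matrix.isUnit_iff_isUnit_det _).1 hM.isUnit)
    ((Matrix.isUnit_iff_isUnit_det _).1 (hM.submatrix he).isUnit) hb)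

end Matrix

/-! ### Orthogonal projection of a finite family of vectors -/

section
variable {n m E : Type*} [Fintype m] [DecidableEq m]
  [NormedAddCommGroup E] [InnerProductSpace ℂ E]

/-- The linear predictor `∑ c, (M_{·C} M_{CC}⁻¹)_{a c} • r (e c)` of `r a`. If `M` is the Gram matrix
of `r` with `M_{CC}` invertible, it is the orthogonal projection of `r a` onto the span of the
`r (e c)`. -/
noncomputable def fittedVector (M : Matrix n n ℂ) (e : m → n) (r : n → E) (a : n) : E :=
  ∑ c, Matrix.regressionCoeff M e a c • r (e c)

theorem inner_sub_fittedVector {M : Matrix n n ℂ} (e : m → n) {r : n → E}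
    (hr : ∀ a b, inner ℂ (r b) (r a) = M a b) (a b : n) :
    inner ℂ (r b) (r a - fittedVector M e r a) = Matrix.partialCov M e a b := by
  simp [fittedVector, Matrix.partialCov, hr, Matrix.mul_apply]

theorem inner_comp_sub_fittedVector {M : Matrix n n ℂ} {e : m → n} (he : Function.Injective e)
    (hM : M.PosDef) {r : n → E} (hr : ∀ a b, inner ℂ (r b) (r a) = M a b) (a : n) (c : m) :
    inner ℂ (r (e c)) (r a - fittedVector M e r a) = 0 := by
  rw [inner_sub_fittedVector e hr]
  exact congr_fun₂ (Matrix.partialCov_submatrix_eq_zero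
    ((Matrix.isUnit_iff_isUnit_det _).1 (hM.submatrix he).isUnit)) a c

theorem inner_fittedVector_sub_fittedVector {M : Matrix n n ℂ} {e : m → n}
    (he : Function.Injective e)
    (hM : M.PosDef) {r : n → E} (hr : ∀ a b, inner ℂ (r b) (r a) = M a b) (a b : n) :
    inner ℂ (fittedVector M e r b) (r a - fittedVector M e r a) = 0 := by
  rw [fittedVector, sum_inner]
  simp [inner_smul_left, inner_comp_sub_fittedVector he hM hr]

theorem inner_residual_residual {M : Matrix n n ℂ} {e : m → n} (he : Function.Injective e)
    (hM : M.PosDef) {r : n → E} (hr : ∀ a b, inner ℂ (r b) (r a) = M a b) (a b : n) :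
    inner ℂ (r b - fittedVector M e r b) (r a - fittedVector M e r a) =
      Matrix.partialCov M e a b := by
  rw [inner_sub_left, inner_fittedVector_sub_fittedVector he hM hr, sub_zero,
    inner_sub_fittedVector e hr]

theorem norm_fittedVector_le {M : Matrix n n ℂ} {e : m → n} (he : Function.Injective e)
    (hM : M.PosDef) {r : n → E} (hr : ∀ a b, inner ℂ (r b) (r a) = M a b) (a : n) :
    ‖fittedVector M e r a‖ ≤ ‖r a‖ := by
  have h := norm_add_sq_eq_norm_sq_add_norm_sq_of_inner_eq_zero _ _
    (inner_fittedVector_sub_fittedVector he hM hr a a)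
  rw [add_sub_cancel] at h
  nlinarith [norm_nonneg (r a), norm_nonneg (fittedVector M e r a),
    mul_self_nonneg ‖r a - fittedVector M e r a‖]

end

/-! ### Modulated functions in `L²(ℝ)` -/

section
variable {m E : Type*} [Fintype m] [NormedAddCommGroup E] [InnerProductSpace ℂ E]

theorem character_inner (s t x : ℝ) (y z : E) :
    inner ℂ (character s x • y) (character t x • z) = character (t - s) x * inner ℂ y z := by
  rw [inner_smul_left, inner_smul_right, ← mul_assoc, star_character_mul]

theorem memLp_character_smul {g : ℝ → E} (hg : MemLp g 2) (t : ℝ) :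
    MemLp (fun x => character t x • g x) 2 := by
  refine hg.of_le ((continuous_character t).aestronglyMeasurable.smul hg.1)
    (Eventually.of_forall fun x => ?_)
  rw [norm_smul, norm_character, one_mul]

/-- The element `x ↦ exp (i x t) g(x)` of `L²(ℝ; E)`. -/
noncomputable def modulated {g : ℝ → E} (hg : MemLp g 2) (t : ℝ) : Lp E 2 (volume : Measure ℝ) :=
  (memLp_character_smul hg t).toLp

theorem inner_modulated {g h : ℝ → E} (hg : MemLp g 2) (hh : MemLp h 2) (s t : ℝ) :
    inner ℂ (modulated hg s) (modulated hh t) =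
      ∫ x, character (t - s) x * inner ℂ (g x) (h x) := by
  rw [L2.inner_def]
  refine integral_congr_ae ?_
  filter_upwards [(memLp_character_smul hg s).coeFn_toLp, (memLp_character_smul hh t).coeFn_toLp]
    with x hx hy
  rw [modulated, modulated, hx, hy, character_inner]

theorem modulated_sub {g h : ℝ → E} (hg : MemLp g 2) (hh : MemLp h 2) (t : ℝ) :
    modulated hg t - modulated hh t = modulated (hg.sub hh) t := by
  unfold modulated
  rw [← MemLp.toLp_sub]
  congr 1
  ext x
  simp [smul_sub]

theorem integrable_inner_of_memLp {g h : ℝ → E} (hg : MemLp g 2) (hh : MemLp h 2) :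
    Integrable fun x => inner ℂ (g x) (h x) := by
  refine (L2.integrable_inner (𝕜 := ℂ) hg.toLp hh.toLp).congr ?_
  filter_upwards [hg.coeFn_toLp, hh.coeFn_toLp] with x hx hy
  rw [hx, hy]

/-- An `L²` combination `∑ c, w c • g c` of functions `g c`, with coefficients depending on the
frequency and not necessarily square integrable, is a limit of trigonometric combinations of the
`g c`: by Fourier uniqueness, an `h` orthogonal to every modulation of every `g c` is pointwise
orthogonal to the `g c`. -/
theorem modulated_mem_closure_span [CompleteSpace E] {g : m → ℝ → E} (hg : ∀ c, MemLp (g c) 2)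
    {w : m → ℝ → ℂ} (hw : MemLp (fun x => ∑ c, w c x • g c x) 2) (t : ℝ)
    {T : Set (Lp E 2 (volume : Measure ℝ))} (hT : ∀ c s, modulated (hg c) s ∈ T) :
    modulated hw t ∈ (Submodule.span ℂ T).topologicalClosure := by
  rw [← Submodule.orthogonal_orthogonal_eq_closure, Submodule.mem_orthogonal']
  intro h hh
  rw [Submodule.mem_orthogonal] at hh
  have hc : ∀ c, ∀ᵐ x : ℝ, inner ℂ (h x) (g c x) = 0 := by
    intro c
    refine ae_eq_zero_of_forall_integral_exp_mul_eq_zero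
      (integrable_inner_of_memLp (Lp.memLp h) (hg c)) fun s => ?_
    have := inner_eq_zero_symm.1 (hh _ (Submodule.subset_span (hT c s)))
    rw [L2.inner_def] at this
    rw [← this]
    refine integral_congr_ae ?_
    filter_upwards [(memLp_character_smul (hg c) s).coeFn_toLp] with x hx
    rw [modulated, hx, inner_smul_right]
  rw [inner_eq_zero_symm, L2.inner_def]
  refine integral_eq_zero_of_ae ?_
  filter_upwards [(memLp_character_smul hw t).coeFn_toLp, ae_all_iff.2 hc] with x hx hcx
  rw [modulated, hx, inner_smul_right, inner_sum]
  simp [inner_smul_right, hcx]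

end

/-! ### Spectral factors -/

section
variable {n m E : Type*} [Fintype m] [DecidableEq m]
  [NormedAddCommGroup E] [InnerProductSpace ℂ E]

/-- The coefficients of the predictor need not be bounded; its norm is controlled because it is an
orthogonal projection of `r a`. -/
theorem memLp_fittedVector {X : Type*} [MeasurableSpace X] {μ : Measure X}
    {F : X → Matrix n n ℂ} (hF : ∀ a b, AEStronglyMeasurable (fun x => F x a b) μ)
    (hpos : ∀ x, (F x).PosDef) {r : n → X → E}
    (hr : ∀ x a b, inner ℂ (r b x) (r a x) = F x a b) (hrL : ∀ a, MemLp (r a) 2 μ)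
    {e : m → n} (he : Function.Injective e) (a : n) :
    MemLp (fun x => fittedVector (F x) e (fun b => r b x) a) 2 μ := by
  refine (hrL a).of_le ?_ (Eventually.of_forall fun x =>
    norm_fittedVector_le he (hpos x) (r := fun b => r b x) (hr x) a)
  refine Finset.aestronglyMeasurable_fun_sum _ fun c _ => AEStronglyMeasurable.smul ?_ (hrL _).1
  simp only [Matrix.regressionCoeff, Matrix.mul_apply]
  refine Finset.aestronglyMeasurable_fun_sum _ fun d _ => (hF _ _).mul ?_
  exact Matrix.aestronglyMeasurable_inv_apply (fun _ _ => hF _ _) _ _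

/-- An integrable family of positive semidefinite matrices is the pointwise Gram matrix of a family of
vector-valued `L²` functions, given by the rows of the square root. -/
theorem exists_memLp_gram_eq [Fintype n] [DecidableEq n] {X : Type*} [MeasurableSpace X]
    {μ : Measure X} {F : X → Matrix n n ℂ} (hF : ∀ a b, Integrable (fun x => F x a b) μ)
    (hpos : ∀ x, (F x).PosSemidef) :
    ∃ r : n → X → EuclideanSpace ℂ n, (∀ a, MemLp (r a) 2 μ) ∧
      ∀ x a b, inner ℂ (r b x) (r a x) = F x a b := by
  obtain ⟨R, hRm, hR⟩ := exists_aestronglyMeasurable_sqrt hpos fun a b => (hF a b).1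
  have hgram : ∀ x a b, inner ℂ (WithLp.toLp 2 (R x b) : EuclideanSpace ℂ n)
      (WithLp.toLp 2 (R x a)) = F x a b := by
    intro x a b
    rw [← hR x, Matrix.mul_apply]
    simp [PiLp.inner_apply]
  refine ⟨fun a x => WithLp.toLp 2 (R x a), fun a => ?_, hgram⟩
  have hm : AEStronglyMeasurable
      (fun x => (WithLp.toLp 2 (R x a) : EuclideanSpace ℂ n)) μ :=
    (PiLp.continuous_toLp 2 _).comp_aestronglyMeasurable
      (aemeasurable_pi_iff.2 fun b => (hRm a b).aemeasurable).aestronglyMeasurable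
  rw [memLp_two_iff_integrable_sq_norm hm]
  have : ∀ x, ‖(WithLp.toLp 2 (R x a) : EuclideanSpace ℂ n)‖ ^ 2 = RCLike.re (F x a a) :=
    fun x => by rw [← hgram x a a, inner_self_eq_norm_sq]
  simp only [this]
  exact (hF a a).re

end

/-! ### The cross-spectrum of the noise processes -/

namespace PartialCorrelation

variable {Ω V : Type*} [MeasurableSpace Ω] {P : Measure Ω} {Y : V → ℝ → Ω → ℂ}

/-- The Gram matrix of the random variables `Y_a(s)` in `L²(P)`, in terms of the spectral density. -/
theorem inner_toLp_eq (hY : IsWideSenseStationary P Y) {f : ℝ → Matrix V V ℂ}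
    (hf : HasSpectralDensity P Y f) (a b : V) (s t : ℝ) :
    inner ℂ (hY.memLp b t).toLp (hY.memLp a s).toLp =
      ∫ x, character (s - t) x * f x a b := by
  have h1 : inner ℂ (hY.memLp b t).toLp (hY.memLp a s).toLp =
      ∫ ω, Y a s ω * star (Y b t ω) ∂P := by
    rw [L2.inner_def]
    refine integral_congr_ae ?_
    filter_upwards [(hY.memLp b t).coeFn_toLp, (hY.memLp a s).coeFn_toLp] with x hx hy
    rw [hx, hy]; rfl
  have h2 := hY.cov a b 0 (s - t) t
  rw [sub_add_cancel, zero_add] at h2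
  rw [h1, h2]
  exact hf.autocov_eq (s - t) a b

theorem integral_noise_mul_star (hY : IsWideSenseStationary P Y) (C : Finset V) (a b : V)
    (s t : ℝ) : ∫ ω, noise hY C a s ω * star (noise hY C b t ω) ∂P =
      inner ℂ (noise hY C b t) (noise hY C a s) := by
  rw [L2.inner_def]; rfl

theorem linearSpace_eq (hY : IsWideSenseStationary P Y) {S C : Finset V} (hC : C ⊆ S) :
    linearSpace P Y C = (Submodule.span ℂ ((fun p : S × ℝ => (hY.memLp p.1.1 p.2).toLp) ''
      {p | p.1.1 ∈ C})).topologicalClosure := by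
  unfold linearSpace
  congr 2
  ext X
  constructor
  · rintro ⟨c, hc, t, h⟩
    exact ⟨(⟨c, hC hc⟩, t), hc, (Lp.ext (h.trans (hY.memLp c t).coeFn_toLp.symm)).symm⟩
  · rintro ⟨p, hp, rfl⟩
    exact ⟨p.1.1, hp, p.2, (hY.memLp _ _).coeFn_toLp⟩

/-- The cross-spectral density of the noise processes given `Y_C` is the Schur complement
`f_{ab} - f_{aC} f_{CC}⁻¹ f_{Cb}`. -/
theorem integral_noise_eq [DecidableEq V] (hY : IsWideSenseStationary P Y) {f : ℝ → Matrix V V ℂ}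
    (hf : HasSpectralDensity P Y f) {S C : Finset V} (hC : C ⊆ S)
    (hpos : ∀ x, (subDensity f S x).PosDef) (a b : S) :
    Integrable (fun x => Matrix.partialCov (subDensity f S x) (Set.inclusion hC) a b) ∧
    ∀ s t : ℝ, ∫ ω, noise hY C a s ω * star (noise hY C b t ω) ∂P =
      ∫ x, character (s - t) x *
        Matrix.partialCov (subDensity f S x) (Set.inclusion hC) a b := by
  have he : Function.Injective (Set.inclusion hC : C → S) := Set.inclusion_injective hC
  have hF : ∀ a b, Integrable (fun x => subDensity f S x a b) := fun a b => hf.integrable a.1 b.1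
  -- `Y_a(t)` corresponds to `x ↦ exp (i x t) r_a(x)`, where `r` factorises the spectral density.
  obtain ⟨r, hrL, hr⟩ := exists_memLp_gram_eq hF fun x => (hpos x).posSemidef
  have hfit := memLp_fittedVector (fun a b => (hF a b).1) hpos hr hrL he
  have hres := fun x => inner_residual_residual he (hpos x) (r := fun b => r b x) (hr x) a b
  constructor
  · simp only [← hres]
    exact integrable_inner_of_memLp ((hrL b).sub (hfit b)) ((hrL a).sub (hfit a))
  intro s t
  have key := inner_residual_eq (u := fun p : S × ℝ => (hY.memLp p.1.1 p.2).toLp)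
    (v := fun p : S × ℝ => modulated (hrL p.1) p.2)
    (fun i j => by
      rw [inner_toLp_eq hY hf, inner_modulated]
      simp only [hr]; rfl) {p | p.1.1 ∈ C} (linearSpace P Y C) (linearSpace_eq hY hC)
    (q := fun p => modulated (hfit p.1) p.2)
    (fun p => modulated_mem_closure_span (fun c => hrL (Set.inclusion hC c)) (hfit p.1) p.2
      fun c s => ⟨(Set.inclusion hC c, s), c.2, rfl⟩)
    (fun i j hj => by
      rw [modulated_sub, inner_modulated]
      have := fun x => inner_comp_sub_fittedVector he (hpos x) (r := fun b => r b x) (hr x) i.1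
        ⟨j.1.1, hj⟩
      refine integral_eq_zero_of_ae (Eventually.of_forall fun x => ?_)
      exact mul_eq_zero_of_right _ (this x)) (b, t) (a, s)
  rw [integral_noise_mul_star]
  refine key.trans ?_
  rw [modulated_sub, modulated_sub, inner_modulated]
  exact integral_congr_ae (Eventually.of_forall fun x => congrArg _ (hres x))

theorem bijective_sumElim_inclusion [DecidableEq V] {A B C : Finset V} (hAB : Disjoint A B)
    (hAC : Disjoint A C) (hBC : Disjoint B C) (hA : A ⊆ A ∪ B ∪ C) (hB : B ⊆ A ∪ B ∪ C)
    (hC : C ⊆ A ∪ B ∪ C) :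
    Function.Bijective (Sum.elim (Sum.elim (fun a : A => (⟨a.1, hA a.2⟩ : ↥(A ∪ B ∪ C)))
      (fun b : B => ⟨b.1, hB b.2⟩)) (Set.inclusion hC : C → ↥(A ∪ B ∪ C))) := by
  rw [Finset.disjoint_left] at hAB hAC hBC
  constructor
  · rintro ((⟨x, hx⟩ | ⟨x, hx⟩) | ⟨x, hx⟩) ((⟨y, hy⟩ | ⟨y, hy⟩) | ⟨y, hy⟩) h <;>
      obtain rfl : x = y := congrArg Subtype.val h
    all_goals first | rfl | grind
  · rintro ⟨x, hx⟩
    rcases Finset.mem_union.1 hx with h | h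
    · rcases Finset.mem_union.1 h with h | h
      · exact ⟨.inl (.inl ⟨x, h⟩), rfl⟩
      · exact ⟨.inl (.inr ⟨x, h⟩), rfl⟩
    · exact ⟨.inr ⟨x, h⟩, rfl⟩

end PartialCorrelation

theorem mainTheorem2 {Ω V : Type*} [MeasurableSpace Ω] [Fintype V] [DecidableEq V]
    (P : Measure Ω) [IsProbabilityMeasure P]
    (Y : V → ℝ → Ω → ℂ)
    (hY : PartialCorrelation.IsWideSenseStationary P Y)
    (hmean : PartialCorrelation.HasMeanZero P Y)
    (hcont : PartialCorrelation.IsMeanSquareContinuous P Y)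
    (f : ℝ → Matrix V V ℂ)
    (hf : PartialCorrelation.HasSpectralDensity P Y f)
    (A B C : Finset V)
    (hAB : Disjoint A B) (hAC : Disjoint A C) (hBC : Disjoint B C)
    (hpos : ∀ x : ℝ, (PartialCorrelation.subDensity f (A ∪ B ∪ C) x).PosDef) :
    PartialCorrelation.PartiallyUncorrelated hY A B C ↔
      ∀ᵐ x : ℝ, PartialCorrelation.block (PartialCorrelation.invDensity f (A ∪ B ∪ C) x)
        (Finset.subset_union_left.trans Finset.subset_union_left : A ⊆ A ∪ B ∪ C)
        (Finset.subset_union_right.trans Finset.subset_union_left : B ⊆ A ∪ B ∪ C) = 0 := by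
  have hA : A ⊆ A ∪ B ∪ C := Finset.subset_union_left.trans Finset.subset_union_left
  have hB : B ⊆ A ∪ B ∪ C := Finset.subset_union_right.trans Finset.subset_union_left
  have hC : C ⊆ A ∪ B ∪ C := Finset.subset_union_right
  have hblock := fun x => Matrix.partialCov_block_eq_zero_iff (hpos x)
    (PartialCorrelation.bijective_sumElim_inclusion hAB hAC hBC hA hB hC)
  have hcov := fun (a : A) (b : B) =>
    PartialCorrelation.integral_noise_eq hY hf hC hpos ⟨a.1, hA a.2⟩ ⟨b.1, hB b.2⟩
  have hae : (∀ᵐ x : ℝ, PartialCorrelation.block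
      (PartialCorrelation.invDensity f (A ∪ B ∪ C) x) hA hB = 0) ↔
      ∀ (a : A) (b : B), ∀ᵐ x : ℝ, Matrix.partialCov (PartialCorrelation.subDensity f (A ∪ B ∪ C) x)
        (Set.inclusion hC) ⟨a.1, hA a.2⟩ ⟨b.1, hB b.2⟩ = 0 := by
    simp only [← ae_all_iff]
    refine eventually_congr (Eventually.of_forall fun x => ?_)
    refine (hblock x).symm.trans ?_
    rw [← Matrix.ext_iff]
    rfl
  rw [hae]
  constructor
  · intro h a b
    refine ae_eq_zero_of_forall_integral_exp_mul_eq_zero (hcov a b).1 fun t => ?_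
    have := (hcov a b).2 t 0
    rw [sub_zero] at this
    exact this.symm.trans (h a a.2 b b.2 t 0)
  · intro h a ha b hb s t
    refine ((hcov ⟨a, ha⟩ ⟨b, hb⟩).2 s t).trans (integral_eq_zero_of_ae ?_)
    filter_upwards [h ⟨a, ha⟩ ⟨b, hb⟩] with x hx
    exact mul_eq_zero_of_right _ hx
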